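/- For a finite simple graph $G$ with vertex set $V$ and a real number $p\ge 1$, let $$\lambda^{(p)}(G)=\max\Big\{2\sum_{\{i,j\}\in E(G)}x_ix_j \;:\; x\in\mathbb{R}^{V},\ \sum_{i\in V}|x_i|^p=1\Big\}$$ be the $p$-spectral radius of $G$, and let $T_r(n)$ be the $r$-partite Turán graph of order $n$, that is, the complete $r$-partite graph on $n$ vertices with parts of size $\lfloor n/r\rfloor$ or $\lceil n/r\rceil$. **Theorem.** Let $p>1$. If $G$ is a graph of order $n\ge 1$ with clique number $\omega$, then $\lambda^{(p)}(G)<\lambda^{(p)}(T_\omega(n))$, unless $G$ is isomorphic to $T_\omega(n)$. -/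

import Mathlib

/-- The quadratic form `P_G(x) = 2 ∑_{{i,j} ∈ E(G)} x_i x_j` of a finite graph `G`. -/
noncomputable def graphForm {V : Type*} [Fintype V] (G : SimpleGraph V) (x : V → ℝ) : ℝ :=
  open Classical in 2 * ∑ e ∈ G.edgeFinset, (e.map x).mul

/-- The `p`-spectral radius `λ^(p)(G)`: the maximum of `P_G(x)` over all real vectors `x` with
`∑ |x_i|^p = 1`. The supremum is attained if `V` is nonempty and `p ≥ 1`; see
`isGreatest_pSpectralRadius`. -/
noncomputable def pSpectralRadius {V : Type*} [Fintype V] (p : ℝ) (G : SimpleGraph V) : ℝ :=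
  sSup (graphForm G '' {x : V → ℝ | ∑ i, |x i| ^ p = 1})

theorem continuous_graphForm {V : Type*} [Fintype V] (G : SimpleGraph V) :
    Continuous (graphForm G) := by
  classical
  unfold graphForm
  refine continuous_const.mul (continuous_finsetSum _ fun e _ => ?_)
  induction e with
  | h a b =>
    simp only [Sym2.map_mk, Sym2.mul_mk]
    fun_prop

/-- The supremum in the definition of the `p`-spectral radius is a maximum. -/
theorem isGreatest_pSpectralRadius {V : Type*} [Fintype V] [Nonempty V] (p : ℝ) (hp : 1 ≤ p)
    (G : SimpleGraph V) :
    IsGreatest (graphForm G '' {x : V → ℝ | ∑ i, |x i| ^ p = 1}) (pSpectralRadius p G) := by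
  classical
  have hp0 : 0 < p := by linarith
  have hclosed : IsClosed {x : V → ℝ | ∑ i, |x i| ^ p = 1} := by
    refine isClosed_eq (continuous_finsetSum _ fun i _ => ?_) continuous_const
    exact (continuous_abs.comp (continuous_apply i)).rpow_const fun _ => Or.inr hp0.le
  have hbdd : Bornology.IsBounded {x : V → ℝ | ∑ i, |x i| ^ p = 1} := by
    refine (Metric.isBounded_closedBall (x := (0 : V → ℝ)) (r := 1)).subset fun x hx => ?_
    rw [mem_closedBall_zero_iff, pi_norm_le_iff_of_nonneg zero_le_one]
    intro i
    have h1 : |x i| ^ p ≤ 1 := by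
      rw [← (show ∑ i, |x i| ^ p = 1 from hx)]
      exact Finset.single_le_sum (f := fun i => |x i| ^ p)
        (fun j _ => Real.rpow_nonneg (abs_nonneg _) _) (Finset.mem_univ i)
    by_contra h
    exact absurd h1 (not_le.mpr (Real.one_lt_rpow (not_le.mp h) hp0))
  have hne : {x : V → ℝ | ∑ i, |x i| ^ p = 1}.Nonempty := by
    obtain ⟨v⟩ := ‹Nonempty V›
    refine ⟨Pi.single v 1, ?_⟩
    rw [Set.mem_ofPred_eq, Finset.sum_eq_single v]
    · simp
    · intro j _ hj
      simp [hj, Real.zero_rpow hp0.ne']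
    · simp
  exact ((Metric.isCompact_of_isClosed_isBounded hclosed hbdd).image
    (continuous_graphForm G)).isGreatest_sSup (hne.image _)

/-! Let `x ≥ 0` attain the `p`-spectral radius of `G`. Erdős's degree-majorisation argument for
Turán's theorem, with vertices weighted by `x`, gives a complete `ω`-partite graph whose form at `x`
is at least that of `G` (`exists_coloring_pairWeight_le`). So it suffices to find the best complete
`ω`-partite graph.

If two part sizes differ by at least two, moving a vertex helps
(`exists_pSpectralRadius_multipartite_lt`): the form depends only on the part sums, and the least
`ℓ^p` cost `m (s / m) ^ p` of a sum `s` on `m` vertices is jointly convex in `(m, s)`. Hence the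
best graph is balanced, that is, Turán.

If `G` is not beaten, all the inequalities are equalities. Then `x` also maximises the form of the
multipartite graph, so it is positive everywhere, and the equality case of the weighted Turán
theorem identifies `G`. -/

/-! ### The quadratic form and its maximisers -/

section QuadraticForm

variable {V : Type*} [Fintype V]

open Classical in
theorem graphForm_eq_sum (G : SimpleGraph V) (x : V → ℝ) :
    graphForm G x = ∑ i, ∑ j, if G.Adj i j then x i * x j else 0 := by
  have h : ∑ q : V × V with G.Adj q.1 q.2, x q.1 * x q.2 =
      ∑ e ∈ G.edgeFinset, 2 * (e.map x).mul := by
    rw [← Finset.sum_fiberwise_of_maps_to (s := Finset.univ.filter fun q : V × V => G.Adj q.1 q.2)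
      (t := G.edgeFinset) (g := fun q => s(q.1, q.2)) (by simp)]
    refine Finset.sum_congr rfl fun e he => ?_
    induction e with
    | h a b =>
      have hab : G.Adj a b := by simpa using he
      have hfib : (Finset.univ.filter fun q : V × V => G.Adj q.1 q.2).filter
          (fun q => s(q.1, q.2) = s(a, b)) = {(a, b), (b, a)} := by
        ext ⟨i, j⟩
        simp only [Finset.mem_filter, Finset.mem_univ, true_and, Sym2.eq_iff, Finset.mem_insert,
          Finset.mem_singleton, Prod.mk.injEq]
        constructor
        · exact fun h => h.2
        · rintro (⟨rfl, rfl⟩ | ⟨rfl, rfl⟩)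
          · exact ⟨hab, by simp⟩
          · exact ⟨hab.symm, by simp⟩
      rw [hfib, Finset.sum_pair (by simp [hab.ne])]
      simp only [Sym2.map_mk, Sym2.mul_mk]
      ring
  rw [Finset.sum_filter, Fintype.sum_prod_type, ← Finset.mul_sum] at h
  unfold graphForm
  convert h.symm

theorem graphForm_smul (G : SimpleGraph V) (t : ℝ) (x : V → ℝ) :
    graphForm G (fun i => t * x i) = t ^ 2 * graphForm G x := by
  classical
  simp only [graphForm_eq_sum, Finset.mul_sum]
  refine Finset.sum_congr rfl fun i _ => Finset.sum_congr rfl fun j _ => ?_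
  split_ifs <;> ring

theorem graphForm_le_graphForm_abs (G : SimpleGraph V) (x : V → ℝ) :
    graphForm G x ≤ graphForm G fun i => |x i| := by
  classical
  simp only [graphForm_eq_sum]
  refine Finset.sum_le_sum fun i _ => Finset.sum_le_sum fun j _ => ?_
  split_ifs
  · rw [← abs_mul]
    exact le_abs_self _
  · exact le_rfl

theorem graphForm_comp_iso {W : Type*} [Fintype W] {G : SimpleGraph V} {H : SimpleGraph W}
    (f : G ≃g H) (x : W → ℝ) : graphForm G (x ∘ f) = graphForm H x := by
  classical
  simp only [graphForm_eq_sum]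
  rw [← Equiv.sum_comp f.toEquiv]
  refine Finset.sum_congr rfl fun i _ => ?_
  rw [← Equiv.sum_comp f.toEquiv]
  refine Finset.sum_congr rfl fun j _ => ?_
  exact if_congr f.map_adj_iff.symm rfl rfl

theorem pSpectralRadius_congr {W : Type*} [Fintype W] {G : SimpleGraph V} {H : SimpleGraph W}
    (f : G ≃g H) (p : ℝ) : pSpectralRadius p G = pSpectralRadius p H := by
  unfold pSpectralRadius
  congr 1
  ext y
  constructor
  · rintro ⟨x, hx, rfl⟩
    refine ⟨x ∘ f.symm, ?_, graphForm_comp_iso f.symm x⟩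
    have := Equiv.sum_comp f.symm.toEquiv fun i => |x i| ^ p
    exact this.trans hx
  · rintro ⟨x, hx, rfl⟩
    refine ⟨x ∘ f, ?_, graphForm_comp_iso f x⟩
    have := Equiv.sum_comp f.toEquiv fun i => |x i| ^ p
    exact this.trans hx

variable [Nonempty V]

theorem graphForm_le_pSpectralRadius {p : ℝ} (hp : 1 ≤ p) (G : SimpleGraph V) {x : V → ℝ}
    (hx : ∑ i, |x i| ^ p = 1) : graphForm G x ≤ pSpectralRadius p G :=
  (isGreatest_pSpectralRadius p hp G).2 ⟨x, hx, rfl⟩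

theorem exists_nonneg_graphForm_eq_pSpectralRadius {p : ℝ} (hp : 1 ≤ p) (G : SimpleGraph V) :
    ∃ x : V → ℝ, (∀ i, 0 ≤ x i) ∧ ∑ i, |x i| ^ p = 1 ∧ graphForm G x = pSpectralRadius p G := by
  obtain ⟨x, hx, hxm⟩ := (isGreatest_pSpectralRadius p hp G).1
  have hx' : ∑ i, |(|x i|)| ^ p = 1 := by simpa using hx
  refine ⟨fun i => |x i|, fun i => abs_nonneg _, hx', le_antisymm ?_ ?_⟩
  · exact graphForm_le_pSpectralRadius hp G hx'
  · exact hxm ▸ graphForm_le_graphForm_abs G x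

/-- Homogeneity of degree 2 removes the normalisation, so that perturbed vectors can serve as test
vectors without rescaling. -/
theorem graphForm_le_pSpectralRadius_mul {p : ℝ} (hp : 1 ≤ p) (G : SimpleGraph V) (x : V → ℝ) :
    graphForm G x ≤ pSpectralRadius p G * (∑ i, |x i| ^ p) ^ (2 / p) := by
  have hp0 : 0 < p := by linarith
  set S := ∑ i, |x i| ^ p with hS
  have hS0 : 0 ≤ S := Finset.sum_nonneg fun i _ => Real.rpow_nonneg (abs_nonneg _) _
  rcases hS0.eq_or_lt with h0 | hpos
  · have hz : ∀ i, x i = 0 := by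
      intro i
      have := (Finset.sum_eq_zero_iff_of_nonneg
        fun i _ => Real.rpow_nonneg (abs_nonneg (x i)) p).1 (hS ▸ h0.symm) i (Finset.mem_univ i)
      simpa using ((Real.rpow_eq_zero_iff_of_nonneg (abs_nonneg _)).1 this).1
    rw [← h0, Real.zero_rpow (by positivity)]
    classical
    simp [graphForm_eq_sum, hz]
  · set t := S ^ (1 / p) with ht
    have htpos : 0 < t := Real.rpow_pos_of_pos hpos _
    have htp : t ^ p = S := by
      rw [ht, ← Real.rpow_mul hS0, one_div_mul_cancel hp0.ne', Real.rpow_one]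
    have ht2 : S ^ (2 / p) = t ^ 2 := by
      rw [ht, ← Real.rpow_natCast, ← Real.rpow_mul hS0]
      congr 1
      push_cast
      ring
    have h1 : ∑ i, |t⁻¹ * x i| ^ p = 1 := by
      simp only [abs_mul, abs_of_pos (inv_pos.2 htpos)]
      simp_rw [Real.mul_rpow (inv_pos.2 htpos).le (abs_nonneg _)]
      rw [← Finset.mul_sum, Real.inv_rpow htpos.le, htp, ← hS, inv_mul_cancel₀ hpos.ne']
    have h2 := graphForm_le_pSpectralRadius hp G h1
    rw [graphForm_smul] at h2
    rw [ht2]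
    calc graphForm G x = t ^ 2 * (t⁻¹ ^ 2 * graphForm G x) := by
          field_simp
      _ ≤ t ^ 2 * pSpectralRadius p G := by gcongr
      _ = _ := mul_comm _ _

theorem pSpectralRadius_pos {p : ℝ} (hp : 1 ≤ p) {G : SimpleGraph V} {u v : V} (h : G.Adj u v) :
    0 < pSpectralRadius p G := by
  classical
  have h1 := graphForm_le_pSpectralRadius_mul hp G fun _ => 1
  have h2 : 0 < graphForm G fun _ => 1 := by
    rw [graphForm_eq_sum]
    refine Finset.sum_pos' (fun i _ => Finset.sum_nonneg fun j _ => by split_ifs <;> norm_num)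
      ⟨u, Finset.mem_univ u, ?_⟩
    refine Finset.sum_pos' (fun j _ => by split_ifs <;> norm_num) ⟨v, Finset.mem_univ v, ?_⟩
    simp [h]
  refine pos_of_mul_pos_left (h2.trans_le h1) (Real.rpow_nonneg ?_ _)
  exact Finset.sum_nonneg fun i _ => Real.rpow_nonneg (abs_nonneg _) _

end QuadraticForm

/-! ### Weighted Turán theorem -/

section WeightedTuran

variable {V : Type*}

open Classical in
/-- The total weight `∑ x i * x j` of the pairs in `A × B` that are related by `R`. -/
noncomputable def pairWeight (x : V → ℝ) (R : V → V → Prop) (A B : Finset V) : ℝ :=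
  ∑ i ∈ A, ∑ j ∈ B, if R i j then x i * x j else 0

variable {x : V → ℝ} {R R' : V → V → Prop} {A B : Finset V}

theorem pairWeight_nonneg (hx : ∀ i, 0 ≤ x i) : 0 ≤ pairWeight x R A B := by
  refine Finset.sum_nonneg fun i _ => Finset.sum_nonneg fun j _ => ?_
  split_ifs
  · exact mul_nonneg (hx i) (hx j)
  · exact le_rfl

theorem pairWeight_congr (h : ∀ i ∈ A, ∀ j ∈ B, (R i j ↔ R' i j)) :
    pairWeight x R A B = pairWeight x R' A B := by
  classical
  exact Finset.sum_congr rfl fun i hi => Finset.sum_congr rfl fun j hj =>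
    if_congr (h i hi j hj) rfl rfl

theorem pairWeight_comm (hR : ∀ i j, R i j → R j i) :
    pairWeight x R A B = pairWeight x R B A := by
  classical
  unfold pairWeight
  rw [Finset.sum_comm]
  refine Finset.sum_congr rfl fun i _ => Finset.sum_congr rfl fun j _ => ?_
  rw [mul_comm]
  exact if_congr ⟨hR j i, hR i j⟩ rfl rfl

theorem pairWeight_filter_add (P : V → Prop) [DecidablePred P] (hR : ∀ i j, R i j → R j i)
    (S : Finset V) : pairWeight x R S S =
      pairWeight x R (S.filter P) (S.filter P) +
        2 * pairWeight x R (S.filter fun i => ¬ P i) (S.filter P) +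
          pairWeight x R (S.filter fun i => ¬ P i) (S.filter fun i => ¬ P i) := by
  have hl : ∀ B, pairWeight x R S B =
      pairWeight x R (S.filter P) B + pairWeight x R (S.filter fun i => ¬ P i) B :=
    fun B => (Finset.sum_filter_add_sum_filter_not S P _).symm
  rw [hl, pairWeight_comm (A := S.filter P) hR,
    pairWeight_comm (A := S.filter fun i => ¬ P i) hR, hl, hl,
    pairWeight_comm (A := S.filter P) (B := S.filter fun i => ¬ P i) hR]
  ring

theorem not_rel_of_pairWeight_eq_zero (hx : ∀ i, 0 < x i) (h : pairWeight x R A B = 0) {i j : V}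
    (hi : i ∈ A) (hj : j ∈ B) : ¬ R i j := by
  classical
  intro hR
  have hnn : ∀ i j, 0 ≤ if R i j then x i * x j else 0 := fun i j => by
    split_ifs
    · exact (mul_pos (hx i) (hx j)).le
    · exact le_rfl
  have h1 := (Finset.sum_eq_zero_iff_of_nonneg fun i _ => Finset.sum_nonneg fun j _ => hnn i j).1
    h i hi
  have h2 := (Finset.sum_eq_zero_iff_of_nonneg fun j _ => hnn i j).1 h1 j hj
  rw [if_pos hR] at h2
  exact (mul_pos (hx i) (hx j)).ne' h2

theorem graphForm_eq_pairWeight [Fintype V] (G : SimpleGraph V) (x : V → ℝ) :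
    graphForm G x = pairWeight x G.Adj Finset.univ Finset.univ :=
  graphForm_eq_sum G x

/-- Weighted Turán theorem, in the manner of Erdős: a graph without `(r + 1)`-cliques on `S` is
dominated in weight by a complete `r`-partite graph, and equality with positive weights forces it
to be that graph. -/
theorem exists_coloring_pairWeight_le (G : SimpleGraph V) (hx : ∀ i, 0 ≤ x i) (r : ℕ) :
    ∀ S : Finset V, G.CliqueFreeOn S (r + 1) → ∃ c : V → ℕ, (∀ i ∈ S, c i < r) ∧
      pairWeight x G.Adj S S ≤ pairWeight x (fun i j => c i ≠ c j) S S ∧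
      ((∀ i, 0 < x i) → pairWeight x G.Adj S S = pairWeight x (fun i j => c i ≠ c j) S S →
        ∀ i ∈ S, ∀ j ∈ S, (G.Adj i j ↔ c i ≠ c j)) := by
  classical
  induction r with
  | zero =>
    intro S hS
    have : S = ∅ := by
      by_contra hne
      obtain ⟨v, hv⟩ := Finset.nonempty_iff_ne_empty.2 hne
      exact hS (t := {v}) (by simpa using hv) (by simp [SimpleGraph.isNClique_iff])
    subst this
    exact ⟨fun _ => 0, by simp, by simp [pairWeight], by simp⟩
  | succ r ih =>
    intro S hS
    rcases S.eq_empty_or_nonempty with rfl | hne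
    · exact ⟨fun _ => 0, by simp, by simp [pairWeight], by simp⟩
    -- Split `S` at a vertex `v` of maximal weighted degree: its neighbours `N` contain no `(r +
    -- 1)`-clique and are coloured by induction; the rest, `A`, becomes the new class `r`.
    set d : V → ℝ := fun i => ∑ j ∈ S, if G.Adj i j then x j else 0 with hd
    obtain ⟨v, hv, hmax⟩ := Finset.exists_max_image S d hne
    set N := S.filter (G.Adj v) with hN
    set A := S.filter fun i => ¬ G.Adj v i with hA
    have hNfree : G.CliqueFreeOn N (r + 1) := by
      have := hS.of_succ G (Finset.mem_coe.2 hv)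
      refine this.subset G fun i hi => ?_
      simpa [hN] using hi
    obtain ⟨c, hc, hle, heq⟩ := ih N hNfree
    set c' : V → ℕ := fun i => if G.Adj v i then c i else r with hc'
    have hcN : ∀ i ∈ N, c' i = c i := fun i hi => if_pos (Finset.mem_filter.1 hi).2
    have hcA : ∀ i ∈ A, c' i = r := fun i hi => if_neg (Finset.mem_filter.1 hi).2
    have hGS := pairWeight_filter_add (x := x) (R := G.Adj) (G.Adj v) (fun _ _ h => G.adj_symm h) S
    have hCS := pairWeight_filter_add (x := x) (R := fun i j => c' i ≠ c' j) (G.Adj v)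
      (fun _ _ h => h.symm) S
    rw [← hN, ← hA] at hGS hCS
    have hCN : pairWeight x (fun i j => c' i ≠ c' j) N N =
        pairWeight x (fun i j => c i ≠ c j) N N :=
      pairWeight_congr fun i hi j hj => by rw [hcN i hi, hcN j hj]
    have hCA : pairWeight x (fun i j => c' i ≠ c' j) A A = 0 := by
      refine Finset.sum_eq_zero fun i hi => Finset.sum_eq_zero fun j hj => ?_
      exact if_neg fun h => h ((hcA i hi).trans (hcA j hj).symm)
    have hdv : d v = ∑ j ∈ N, x j := by
      rw [hd, hN, Finset.sum_filter]
    have hCAN : pairWeight x (fun i j => c' i ≠ c' j) A N = ∑ a ∈ A, x a * d v := by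
      rw [hdv]
      refine Finset.sum_congr rfl fun i hi => ?_
      rw [Finset.mul_sum]
      refine Finset.sum_congr rfl fun j hj => ?_
      refine if_pos fun h => (hc j hj).ne ?_
      rw [← hcN j hj, ← hcA i hi]
      exact h.symm
    have hsplit : ∀ a, d a = (∑ j ∈ N, if G.Adj a j then x j else 0) +
        ∑ j ∈ A, if G.Adj a j then x j else 0 :=
      fun a => (Finset.sum_filter_add_sum_filter_not S _ _).symm
    have hGA : pairWeight x G.Adj A N + pairWeight x G.Adj A A = ∑ a ∈ A, x a * d a := by
      unfold pairWeight
      rw [← Finset.sum_add_distrib]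
      refine Finset.sum_congr rfl fun a _ => ?_
      rw [hsplit, mul_add, Finset.mul_sum, Finset.mul_sum]
      simp only [mul_ite, mul_zero]
    have hAA := pairWeight_nonneg (R := G.Adj) (A := A) (B := A) hx
    have hdle : ∀ a ∈ A, x a * d a ≤ x a * d v := fun a ha =>
      mul_le_mul_of_nonneg_left (hmax a (Finset.mem_filter.1 ha).1) (hx a)
    have hsum := Finset.sum_le_sum hdle
    -- Outside `N × N` the graph has weight `2 ∑ a ∈ A, x a * d a` minus that of `A × A`, and the
    -- colouring has `2 ∑ a ∈ A, x a * d v`. Equality therefore forces equality in each estimate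
    -- used.
    refine ⟨c', fun i hi => ?_, by linarith, fun hpos he => ?_⟩
    · simp only [hc']
      split_ifs with h
      · exact (hc i (Finset.mem_filter.2 ⟨hi, h⟩)).trans (Nat.lt_succ_self r)
      · exact Nat.lt_succ_self r
    have hA0 : pairWeight x G.Adj A A = 0 := by linarith
    have hNeq : pairWeight x G.Adj N N = pairWeight x (fun i j => c i ≠ c j) N N := by linarith
    have hAeq : ∑ a ∈ A, x a * d a = ∑ a ∈ A, x a * d v := by linarith
    have hAind : ∀ a ∈ A, ∀ b ∈ A, ¬ G.Adj a b := fun a ha b hb =>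
      not_rel_of_pairWeight_eq_zero hpos hA0 ha hb
    have hAN : ∀ a ∈ A, ∀ j ∈ N, G.Adj a j := by
      intro a ha j hj
      -- As `A` is independent, `a` reaches the degree `d v`, the full weight of `N`, only by being
      -- adjacent to all of `N`.
      have h1 : d a = d v :=
        mul_left_cancel₀ (hpos a).ne' ((Finset.sum_eq_sum_iff_of_le hdle).1 hAeq a ha)
      rw [hsplit, hdv, Finset.sum_eq_zero (s := A) (fun j hj => if_neg (hAind a ha j hj)),
        add_zero] at h1
      have h2 := (Finset.sum_eq_sum_iff_of_le fun j _ => by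
        split_ifs
        · exact le_rfl
        · exact hx j).1 h1 j hj
      by_contra hcon
      rw [if_neg hcon] at h2
      exact (hpos j).ne h2
    have hcases : ∀ i ∈ S, i ∈ N ∨ i ∈ A := fun i hi => by
      by_cases h : G.Adj v i
      · exact Or.inl (Finset.mem_filter.2 ⟨hi, h⟩)
      · exact Or.inr (Finset.mem_filter.2 ⟨hi, h⟩)
    intro i hi j hj
    rcases hcases i hi with hi' | hi' <;> rcases hcases j hj with hj' | hj'
    · rw [hcN i hi', hcN j hj']
      exact heq hpos hNeq i hi' j hj'
    · rw [hcN i hi', hcA j hj']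
      exact iff_of_true (hAN j hj' i hi').symm (hc i hi').ne
    · rw [hcA i hi', hcN j hj']
      exact iff_of_true (hAN i hi' j hj') (hc j hj').ne'
    · rw [hcA i hi', hcA j hj']
      exact iff_of_false (hAind i hi' j hj') (by simp)

end WeightedTuran

/-! ### Convexity of the perspective of the `p`-th power -/

section Perspective

theorem perspective_rpow_mul {p θ : ℝ} (hθ : 0 < θ) (m s : ℝ) :
    (θ * m) * ((θ * s) / (θ * m)) ^ p = θ * (m * (s / m) ^ p) := by
  rw [mul_div_mul_left _ _ hθ.ne', mul_assoc]

/-- Strict convexity of the power at `s / m` and `t / n`, with weights proportional to `m` and `n`.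
-/
theorem perspective_rpow_add_lt {p m n s t : ℝ} (hp : 1 < p) (hm : 0 < m) (hn : 0 < n)
    (hs : 0 ≤ s) (ht : 0 ≤ t) (h : s / m ≠ t / n) :
    (m + n) * ((s + t) / (m + n)) ^ p < m * (s / m) ^ p + n * (t / n) ^ p := by
  have hmn : 0 < m + n := add_pos hm hn
  have key := (strictConvexOn_rpow hp).2 (div_nonneg hs hm.le) (div_nonneg ht hn.le) h
    (div_pos hm hmn) (div_pos hn hmn) (by field_simp)
  simp only [smul_eq_mul] at key
  have e : m / (m + n) * (s / m) + n / (m + n) * (t / n) = (s + t) / (m + n) := by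
    field_simp
  rw [e] at key
  calc _ < (m + n) * (m / (m + n) * (s / m) ^ p + n / (m + n) * (t / n) ^ p) :=
        mul_lt_mul_of_pos_left key hmn
    _ = _ := by field_simp

/-- The case `n = 0` is kept because a vertex may be moved into an empty part. -/
theorem perspective_rpow_add_le {p m n s t : ℝ} (hp : 1 < p) (hm : 0 < m) (hn : 0 ≤ n)
    (hs : 0 ≤ s) (ht : 0 ≤ t) (hnt : n = 0 → t = 0) :
    (m + n) * ((s + t) / (m + n)) ^ p ≤ m * (s / m) ^ p + n * (t / n) ^ p := by
  rcases hn.eq_or_lt with rfl | hn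
  · simp [hnt rfl]
  · by_cases h : s / m = t / n
    · have e : (s + t) / (m + n) = s / m := by
        rw [div_eq_div_iff hm.ne' hn.ne'] at h
        rw [div_eq_div_iff (by positivity) hm.ne']
        linarith
      rw [e, ← h, add_mul]
    · exact (perspective_rpow_add_lt hp hm hn hs ht h).le

theorem perspective_rpow_mix_le {p θ m n s t : ℝ} (hp : 1 < p) (hθ : 0 < θ) (hθ' : 0 < 1 - θ)
    (hm : 0 < m) (hn : 0 ≤ n) (hs : 0 ≤ s) (ht : 0 ≤ t) (hnt : n = 0 → t = 0) :
    ((1 - θ) * m + θ * n) * (((1 - θ) * s + θ * t) / ((1 - θ) * m + θ * n)) ^ p ≤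
      (1 - θ) * (m * (s / m) ^ p) + θ * (n * (t / n) ^ p) := by
  rw [← perspective_rpow_mul hθ', ← perspective_rpow_mul hθ]
  exact perspective_rpow_add_le hp (mul_pos hθ' hm) (mul_nonneg hθ.le hn) (mul_nonneg hθ'.le hs)
    (mul_nonneg hθ.le ht) fun h => by rw [hnt ((mul_eq_zero.1 h).resolve_left hθ.ne'), mul_zero]

theorem perspective_rpow_mix_lt {p θ m n s t : ℝ} (hp : 1 < p) (hθ : 0 < θ) (hθ' : 0 < 1 - θ)
    (hm : 0 < m) (hn : 0 < n) (hs : 0 ≤ s) (ht : 0 ≤ t) (h : s / m ≠ t / n) :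
    ((1 - θ) * m + θ * n) * (((1 - θ) * s + θ * t) / ((1 - θ) * m + θ * n)) ^ p <
      (1 - θ) * (m * (s / m) ^ p) + θ * (n * (t / n) ^ p) := by
  rw [← perspective_rpow_mul hθ', ← perspective_rpow_mul hθ]
  refine perspective_rpow_add_lt hp (mul_pos hθ' hm) (mul_pos hθ hn) (mul_nonneg hθ'.le hs)
    (mul_nonneg hθ.le ht) ?_
  rwa [mul_div_mul_left _ _ hθ'.ne', mul_div_mul_left _ _ hθ.ne']

/-- Power mean inequality: constant weights are the cheapest way to realise a given sum. -/
theorem card_mul_rpow_mean_le {ι : Type*} {p : ℝ} (hp : 1 < p) (A : Finset ι) {x : ι → ℝ}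
    (hx : ∀ i, 0 ≤ x i) :
    (A.card : ℝ) * ((∑ i ∈ A, x i) / A.card) ^ p ≤ ∑ i ∈ A, x i ^ p := by
  rcases A.eq_empty_or_nonempty with rfl | hA
  · simp
  have hc : (0 : ℝ) < A.card := by exact_mod_cast hA.card_pos
  have h := Real.rpow_sum_le_const_mul_sum_rpow A x hp.le
  simp only [abs_of_nonneg (hx _)] at h
  have hcp : (0 : ℝ) < (A.card : ℝ) ^ (p - 1) := Real.rpow_pos_of_pos hc _
  rw [Real.div_rpow (Finset.sum_nonneg fun i _ => hx i) hc.le]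
  have e : (A.card : ℝ) ^ p = A.card ^ (p - 1) * A.card := by
    rw [← Real.rpow_add_one hc.ne', sub_add_cancel]
  rw [e]
  calc _ = (∑ i ∈ A, x i) ^ p / (A.card : ℝ) ^ (p - 1) := by field_simp
    _ ≤ _ := by rw [div_le_iff₀' hcp]; exact h

end Perspective

theorem Fintype.sum_eq_sum_add_of_eq_off_pair {ι : Type*} [Fintype ι] {a b : ι} (hab : a ≠ b)
    {f g : ι → ℝ} (h : ∀ k, k ≠ a → k ≠ b → f k = g k) :
    ∑ k, f k = ∑ k, g k + ((f a + f b) - (g a + g b)) := by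
  classical
  have h1 : ∑ k, (f k - g k) = (f a - g a) + (f b - g b) :=
    Fintype.sum_eq_add a b hab fun k hk => sub_eq_zero.2 (h k hk.1 hk.2)
  rw [Finset.sum_sub_distrib] at h1
  linarith

/-! ### Balancing the parts -/

section Multipartite

variable {V : Type*} [Fintype V] {r : ℕ}

/-- The complete multipartite graph whose parts are the colour classes of `c`. -/
abbrev multipartite (c : V → Fin r) : SimpleGraph V :=
  (⊤ : SimpleGraph (Fin r)).comap c

omit [Fintype V] in
theorem multipartite_adj (c : V → Fin r) {i j : V} : (multipartite c).Adj i j ↔ c i ≠ c j := by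
  simp

/-- The form sees only the part sums, so weights can be averaged within a part without changing it.
-/
theorem graphForm_multipartite (c : V → Fin r) (x : V → ℝ) :
    graphForm (multipartite c) x =
      (∑ k, ∑ i with c i = k, x i) ^ 2 - ∑ k, (∑ i with c i = k, x i) ^ 2 := by
  classical
  have h1 : ∑ k, ∑ i with c i = k, x i = ∑ i, x i := Finset.sum_fiberwise _ _ _
  have h2 : ∀ k, (∑ i with c i = k, x i) ^ 2 =
      ∑ i with c i = k, ∑ j, if c i = c j then x i * x j else 0 := by
    intro k
    rw [sq, Finset.sum_mul]
    refine Finset.sum_congr rfl fun i hi => ?_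
    rw [Finset.mul_sum, Finset.sum_filter]
    refine Finset.sum_congr rfl fun j _ => ?_
    exact if_congr (by rw [(Finset.mem_filter.1 hi).2, eq_comm]) rfl rfl
  simp only [h2]
  rw [h1, Finset.sum_fiberwise, graphForm_eq_sum, sq, Finset.sum_mul, ← Finset.sum_sub_distrib]
  refine Finset.sum_congr rfl fun i _ => ?_
  rw [Finset.mul_sum, ← Finset.sum_sub_distrib]
  refine Finset.sum_congr rfl fun j _ => ?_
  by_cases h : c i = c j <;> simp [h]

/-- Moving a vertex from a part to another one that is smaller by at least two, and averaging the
weights accordingly, increases the `p`-spectral radius. -/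
theorem exists_pSpectralRadius_multipartite_lt [Nonempty V] {p : ℝ} (hp : 1 < p) {c : V → Fin r}
    {x : V → ℝ} (hx : ∀ i, 0 < x i) (hx1 : ∑ i, |x i| ^ p = 1)
    (hM : graphForm (multipartite c) x = pSpectralRadius p (multipartite c))
    (hpos : 0 < pSpectralRadius p (multipartite c)) {a b : Fin r}
    (hab : (Finset.univ.filter fun i => c i = b).card + 2 ≤
      (Finset.univ.filter fun i => c i = a).card) :
    ∃ c' : V → Fin r,
      pSpectralRadius p (multipartite c) < pSpectralRadius p (multipartite c') := by
  classical
  have hne : a ≠ b := by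
    rintro rfl
    omega
  set A := Finset.univ.filter fun i => c i = a with hA
  set B := Finset.univ.filter fun i => c i = b with hB
  obtain ⟨v, hv⟩ : A.Nonempty := Finset.card_pos.1 (by omega)
  have hva : c v = a := (Finset.mem_filter.1 hv).2
  have hvB : v ∉ B := fun h => hne (hva.symm.trans (Finset.mem_filter.1 h).2)
  set c' : V → Fin r := Function.update c v b with hc'
  have hfa : (Finset.univ.filter fun i => c' i = a) = A.erase v := by
    ext i
    by_cases hi : i = v
    · subst hi; simp [hc', hne.symm]
    · simp [hc', hi, hA]
  have hfb : (Finset.univ.filter fun i => c' i = b) = insert v B := by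
    ext i
    by_cases hi : i = v
    · subst hi; simp [hc']
    · simp [hc', hi, hB]
  have hfk : ∀ k, k ≠ a → k ≠ b →
      (Finset.univ.filter fun i => c' i = k) = Finset.univ.filter fun i => c i = k := by
    intro k hka hkb
    ext i
    by_cases hi : i = v
    · subst hi; simp [hc', hva, hka.symm, hkb.symm]
    · simp [hc', hi]
  set m := (A.card : ℝ) with hm
  set n := (B.card : ℝ) with hn
  have hmn : n + 2 ≤ m := by rw [hm, hn]; exact_mod_cast hab
  have hn0 : 0 ≤ n := Nat.cast_nonneg _
  have hm0 : 0 < m := by linarith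
  have hcardA : ((A.erase v).card : ℝ) = m - 1 := by
    rw [Finset.card_erase_of_mem hv, Nat.cast_sub (by omega), Nat.cast_one]
  have hcardB : ((insert v B).card : ℝ) = n + 1 := by
    rw [Finset.card_insert_of_notMem hvB, Nat.cast_add, Nat.cast_one]
  set s := ∑ i ∈ A, x i with hs
  set t := ∑ i ∈ B, x i with ht
  have hs0 : 0 < s := Finset.sum_pos (fun i _ => hx i) ⟨v, hv⟩
  have ht0 : 0 ≤ t := Finset.sum_nonneg fun i _ => (hx i).le
  have hnt : n = 0 → t = 0 := by
    intro h
    rw [hn, Nat.cast_eq_zero, Finset.card_eq_zero] at h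
    simp [ht, h]
  have htn : t ≠ 0 → 0 < n := fun h => hn0.lt_of_ne fun h' => h (hnt h'.symm)
  -- This `θ` makes the new sizes `m - 1`, `n + 1` convex combinations of `m` and `n`; the part sums
  -- are mixed with the same coefficients.
  set θ : ℝ := 1 / (m - n) with hθ
  have hθ0 : 0 < θ := by
    apply one_div_pos.2
    linarith
  have hθ1 : 0 < 1 - θ := by
    have : θ ≤ 1 / 2 := one_div_le_one_div_of_le (by norm_num) (by linarith)
    linarith
  have hθmn : θ * (m - n) = 1 := one_div_mul_cancel (by linarith)
  set u := (1 - θ) * s + θ * t with hu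
  set w := θ * s + (1 - θ) * t with hw
  have hm' : m - 1 = (1 - θ) * m + θ * n := by linarith
  have hn' : n + 1 = θ * m + (1 - θ) * n := by linarith
  have hu0 : 0 ≤ u := by positivity
  have hw0 : 0 ≤ w := by positivity
  set y : V → ℝ := fun i => if c' i = a then u / (m - 1) else if c' i = b then w / (n + 1) else x i
    with hy
  have hya : ∀ i ∈ A.erase v, y i = u / (m - 1) := fun i hi => by
    rw [← hfa] at hi
    exact if_pos (Finset.mem_filter.1 hi).2
  have hyb : ∀ i ∈ insert v B, y i = w / (n + 1) := fun i hi => by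
    rw [← hfb] at hi
    have := (Finset.mem_filter.1 hi).2
    simp only [hy]
    rw [if_neg (by rw [this]; exact hne.symm), if_pos this]
  have hyk : ∀ k, k ≠ a → k ≠ b → ∀ i, c i = k → y i = x i := fun k hka hkb i hi => by
    have : i ∈ Finset.univ.filter fun i => c' i = k := by
      rw [hfk k hka hkb]; simpa using hi
    have := (Finset.mem_filter.1 this).2
    simp only [hy]
    rw [if_neg (by rw [this]; exact hka), if_neg (by rw [this]; exact hkb)]
  have hy0 : ∀ i, 0 ≤ y i := fun i => by
    simp only [hy]
    split_ifs
    · exact div_nonneg hu0 (by linarith)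
    · exact div_nonneg hw0 (by linarith)
    · exact (hx i).le
  have hsa : ∑ i ∈ A.erase v, y i = u := by
    rw [Finset.sum_congr rfl hya, Finset.sum_const, nsmul_eq_mul, hcardA]
    have : m - 1 ≠ 0 := by linarith
    field_simp
  have hsb : ∑ i ∈ insert v B, y i = w := by
    rw [Finset.sum_congr rfl hyb, Finset.sum_const, nsmul_eq_mul, hcardB]
    have : n + 1 ≠ 0 := by linarith
    field_simp
  have hsk : ∀ k, k ≠ a → k ≠ b → ∑ i with c' i = k, y i = ∑ i with c i = k, x i := by
    intro k hka hkb
    rw [hfk k hka hkb]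
    exact Finset.sum_congr rfl fun i hi => hyk k hka hkb i (Finset.mem_filter.1 hi).2
  have hform : graphForm (multipartite c') y =
      graphForm (multipartite c) x + 2 * (θ * (1 - θ)) * (s - t) ^ 2 := by
    rw [graphForm_multipartite, graphForm_multipartite,
      Fintype.sum_eq_sum_add_of_eq_off_pair hne hsk,
      Fintype.sum_eq_sum_add_of_eq_off_pair hne (f := fun k => (∑ i with c' i = k, y i) ^ 2)
        fun k hka hkb => by rw [hsk k hka hkb]]
    simp only [hfa, hfb, hsa, hsb, ← hA, ← hB, ← hs, ← ht, hu, hw]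
    ring
  have hpa : ∑ i ∈ A.erase v, y i ^ p = (m - 1) * (u / (m - 1)) ^ p := by
    rw [Finset.sum_congr rfl fun i hi => by rw [hya i hi], Finset.sum_const, nsmul_eq_mul, hcardA]
  have hpb : ∑ i ∈ insert v B, y i ^ p = (n + 1) * (w / (n + 1)) ^ p := by
    rw [Finset.sum_congr rfl fun i hi => by rw [hyb i hi], Finset.sum_const, nsmul_eq_mul, hcardB]
  have hsum : ∑ i, |y i| ^ p = 1 + (((m - 1) * (u / (m - 1)) ^ p + (n + 1) * (w / (n + 1)) ^ p) -
      (∑ i ∈ A, x i ^ p + ∑ i ∈ B, x i ^ p)) := by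
    have hx1' : ∑ k, ∑ i with c i = k, x i ^ p = 1 := by
      rw [Finset.sum_fiberwise, ← hx1]
      simp only [abs_of_pos (hx _)]
    simp only [abs_of_nonneg (hy0 _)]
    rw [← Finset.sum_fiberwise Finset.univ c' fun i => y i ^ p,
      Fintype.sum_eq_sum_add_of_eq_off_pair hne (g := fun k => ∑ i with c i = k, x i ^ p)]
    · rw [hx1', hfa, hfb, hpa, hpb]
    · intro k hka hkb
      rw [hfk k hka hkb]
      exact Finset.sum_congr rfl fun i hi => by rw [hyk k hka hkb i (Finset.mem_filter.1 hi).2]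
  have hJA := card_mul_rpow_mean_le hp A fun i => (hx i).le
  have hJB := card_mul_rpow_mean_le hp B fun i => (hx i).le
  have hCA := perspective_rpow_mix_le hp hθ0 hθ1 hm0 hn0 hs0.le ht0 hnt
  have hCB : (n + 1) * (w / (n + 1)) ^ p ≤ θ * (m * (s / m) ^ p) + (1 - θ) * (n * (t / n) ^ p) := by
    -- The coefficients are swapped rather than the parts, since only `n` is allowed to vanish.
    have h := perspective_rpow_mix_le (θ := 1 - θ) hp hθ1 (by rwa [sub_sub_cancel]) hm0 hn0 hs0.le
      ht0 hnt
    rwa [sub_sub_cancel, ← hn', ← hw] at h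
  have hCA' : s = t → (m - 1) * (u / (m - 1)) ^ p <
      (1 - θ) * (m * (s / m) ^ p) + θ * (n * (t / n) ^ p) := by
    intro hst
    have hn1 : 0 < n := htn (hst ▸ hs0.ne')
    have h := perspective_rpow_mix_lt hp hθ0 hθ1 hm0 hn1 hs0.le ht0 (by
      rw [← hst]
      intro h
      rw [div_eq_div_iff hm0.ne' hn1.ne'] at h
      have := mul_left_cancel₀ hs0.ne' h
      linarith)
    rwa [← hm', ← hu] at h
  rw [← hm', ← hu] at hCA
  rw [← hm, ← hs] at hJA
  rw [← hn, ← ht] at hJB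
  have hSle : ∑ i, |y i| ^ p ≤ 1 := by linarith
  have hSnn : 0 ≤ ∑ i, |y i| ^ p :=
    Finset.sum_nonneg fun i _ => Real.rpow_nonneg (abs_nonneg _) _
  have h2p : 0 < 2 / p := by positivity
  refine ⟨c', ?_⟩
  by_contra! hcon
  have hbound := (graphForm_le_pSpectralRadius_mul hp.le (multipartite c') y).trans
    (mul_le_mul_of_nonneg_right hcon (Real.rpow_nonneg hSnn (2 / p)))
  rw [hform, hM] at hbound
  -- For `s = t` the form is unchanged but the cost drops strictly, as `s / m ≠ t / n`; otherwise
  -- the form itself grows at no greater cost.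
  by_cases hst : s = t
  · have hlt : ∑ i, |y i| ^ p < 1 := by linarith [hCA' hst]
    have := mul_lt_mul_of_pos_left (Real.rpow_lt_one hSnn hlt h2p) hpos
    rw [hst] at hbound
    linarith
  · have h1 := mul_le_mul_of_nonneg_left (Real.rpow_le_one hSnn hSle h2p.le) hpos.le
    have h2 : 0 < 2 * (θ * (1 - θ)) * (s - t) ^ 2 := by
      have := sq_pos_of_ne_zero (sub_ne_zero.2 hst)
      positivity
    linarith

end Multipartite

/-! ### Positivity of maximisers -/

section Positivity

variable {V : Type*} [Fintype V]

theorem graphForm_update_ge [DecidableEq V] (G : SimpleGraph V) {x : V → ℝ} (hx : ∀ i, 0 ≤ x i)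
    {i j : V} (hij : G.Adj i j) (hi : x i = 0) {δ : ℝ} (hδ : 0 ≤ δ) :
    graphForm G x + 2 * (δ * x j) ≤ graphForm G (Function.update x i δ) := by
  classical
  have h1 : ∀ k l : V, (∑ a, ∑ b, if a = k ∧ b = l then δ * x j else 0) = δ * x j := by
    intro k l
    simp [ite_and]
  -- The gain is spread over the ordered pairs `(i, j)` and `(j, i)` so that the double sums compare
  -- termwise.
  have h2 : 2 * (δ * x j) = (∑ a, ∑ b, if a = i ∧ b = j then δ * x j else 0) +
      ∑ a, ∑ b, if a = j ∧ b = i then δ * x j else 0 := by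
    rw [h1, h1, two_mul]
  clear h1
  rw [graphForm_eq_sum, graphForm_eq_sum, h2]
  simp only [← Finset.sum_add_distrib]
  refine Finset.sum_le_sum fun a _ => Finset.sum_le_sum fun b _ => ?_
  have hx' : ∀ a, 0 ≤ Function.update x i δ a := fun a => by
    by_cases h : a = i
    · subst h; simpa using hδ
    · simpa [h] using hx a
  by_cases hab : G.Adj a b
  · rcases eq_or_ne a i with rfl | ha
    · have hb : b ≠ a := hab.ne'
      by_cases hbj : b = j
      · subst hbj; simp [hab, hi, hb, hb.symm]
      · simp [hab, hi, hb, hbj, hij.ne, mul_nonneg hδ (hx b)]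
    · rcases eq_or_ne b i with rfl | hb
      · by_cases haj : a = j
        · subst haj; simp [hab, hi, ha, mul_comm]
        · simp [hab, hi, ha, haj, mul_nonneg (hx a) hδ]
      · simp [hab, ha, hb]
  · have h1 : ¬ (a = i ∧ b = j) := by
      rintro ⟨rfl, rfl⟩; exact hab hij
    have h2 : ¬ (a = j ∧ b = i) := by
      rintro ⟨rfl, rfl⟩; exact hab hij.symm
    simp [hab, h1, h2]

/-- A maximiser is positive at every vertex that has a neighbour of positive weight. -/
theorem pos_of_adj_of_graphForm_eq_pSpectralRadius [Nonempty V] {p : ℝ} (hp : 1 < p)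
    (G : SimpleGraph V) {x : V → ℝ} (hx : ∀ i, 0 ≤ x i) (hx1 : ∑ i, |x i| ^ p = 1)
    (hM : graphForm G x = pSpectralRadius p G) {i j : V} (hij : G.Adj i j) (hj : 0 < x j) :
    0 < x i := by
  classical
  refine (hx i).lt_of_ne' fun hi => ?_
  have hMpos := pSpectralRadius_pos hp.le hij
  set M := pSpectralRadius p G with hMdef
  -- Raising `x i` from `0` to `δ` gains at least `2 * δ * x j`, while normalisation costs at most
  -- `3 * M * δ ^ p`. With `δ ^ p = ε * δ` the cost is at most `δ * x j`, a contradiction.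
  set ε := min 1 (x j / (3 * M)) with hε
  have hε0 : 0 < ε := lt_min one_pos (by positivity)
  have hε1 : ε ≤ 1 := min_le_left _ _
  have hεM : 3 * M * ε ≤ x j := by
    have : ε ≤ x j / (3 * M) := min_le_right _ _
    rwa [le_div_iff₀' (by positivity)] at this
  have hp1 : 0 < p - 1 := by linarith
  set δ := ε ^ (1 / (p - 1)) with hδ
  have hδ0 : 0 < δ := Real.rpow_pos_of_pos hε0 _
  have hδ1 : δ ≤ 1 := Real.rpow_le_one hε0.le hε1 (by positivity)
  have hδp : δ ^ p = ε * δ := by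
    have : δ ^ (p - 1) = ε := by
      rw [hδ, ← Real.rpow_mul hε0.le, one_div_mul_cancel hp1.ne', Real.rpow_one]
    rw [← this, ← Real.rpow_add_one hδ0.ne', sub_add_cancel]
  have hδp0 : 0 ≤ δ ^ p := Real.rpow_nonneg hδ0.le _
  have hδp1 : δ ^ p ≤ 1 := Real.rpow_le_one hδ0.le hδ1 (by linarith)
  have hsum : ∑ k, |Function.update x i δ k| ^ p = 1 + δ ^ p := by
    have e : ∀ k, |Function.update x i δ k| ^ p = |x k| ^ p + if k = i then δ ^ p else 0 := by
      intro k
      by_cases hk : k = i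
      · subst hk
        simp [hi, abs_of_pos hδ0, Real.zero_rpow (show p ≠ 0 by linarith)]
      · simp [hk]
    simp only [e, Finset.sum_add_distrib, hx1]
    simp
  have h1 := graphForm_update_ge G hx hij hi hδ0.le
  have h2 := graphForm_le_pSpectralRadius_mul hp.le G (Function.update x i δ)
  rw [hsum] at h2
  have h3 : (1 + δ ^ p) ^ (2 / p) ≤ (1 + δ ^ p) ^ (2 : ℝ) :=
    Real.rpow_le_rpow_of_exponent_le (by linarith)
      ((div_le_iff₀ (by linarith)).2 (by linarith))
  rw [Real.rpow_two] at h3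
  have h4 : (1 + δ ^ p) ^ 2 ≤ 1 + 3 * δ ^ p := by nlinarith
  have h5 := mul_le_mul_of_nonneg_left (h3.trans h4) hMpos.le
  rw [hM] at h1
  have h6 : 2 * (δ * x j) ≤ 3 * M * (ε * δ) := by
    rw [← hδp]
    linarith
  have h7 := mul_le_mul_of_nonneg_right hεM hδ0.le
  have h8 := mul_pos hδ0 hj
  linarith

end Positivity

/-! ### The optimal multipartite graph -/

section Turan

variable {V : Type*} [Fintype V] {r : ℕ}

/-- An empty class would cap all the others at one vertex, too few for `r` vertices. A
`Finpartition` has no empty parts, so this is what makes the number of parts exactly `r`. -/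
theorem colorClass_nonempty_of_balanced (hr : r ≤ Fintype.card V) {c : V → Fin r}
    (hc : ∀ a b, (Finset.univ.filter fun i => c i = a).card ≤
      (Finset.univ.filter fun i => c i = b).card + 1) (b : Fin r) :
    (Finset.univ.filter fun i => c i = b).Nonempty := by
  by_contra hb
  rw [Finset.not_nonempty_iff_eq_empty] at hb
  have h1 : Fintype.card V = ∑ a, (Finset.univ.filter fun i => c i = a).card :=
    Finset.card_eq_sum_card_fiberwise fun _ _ => Finset.mem_coe.2 (Finset.mem_univ _)
  have h2 : ∑ a, (Finset.univ.filter fun i => c i = a).card < ∑ _a : Fin r, 1 := by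
    refine Finset.sum_lt_sum (fun a _ => ?_) ⟨b, Finset.mem_univ b, by simp [hb]⟩
    simpa [hb] using hc a b
  simp at h2
  omega

theorem nonempty_iso_turanGraph_of_balanced (hr : r ≤ Fintype.card V) {c : V → Fin r}
    (hc : ∀ a b, (Finset.univ.filter fun i => c i = a).card ≤
      (Finset.univ.filter fun i => c i = b).card + 1) :
    Nonempty (multipartite c ≃g SimpleGraph.turanGraph (Fintype.card V) r) := by
  classical
  have hne := colorClass_nonempty_of_balanced hr hc
  set P : Finpartition (Finset.univ : Finset V) := Finpartition.ofSetoid (Setoid.ker c) with hP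
  have hpart : ∀ i, P.part i = Finset.univ.filter fun j => c j = c i := by
    intro i
    ext j
    rw [hP, Finpartition.mem_part_ofSetoid_iff_rel, Setoid.ker_def]
    simp [eq_comm]
  have hparts : P.parts = Finset.univ.image fun a => Finset.univ.filter fun j => c j = a := by
    ext A
    simp only [Finset.mem_image, Finset.mem_univ, true_and]
    constructor
    · intro hA
      obtain ⟨i, hi⟩ := P.nonempty_of_mem_parts hA
      exact ⟨c i, by rw [← hpart, P.part_eq_of_mem hA hi]⟩
    · rintro ⟨a, rfl⟩
      obtain ⟨i, hi⟩ := hne a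
      rw [← (Finset.mem_filter.1 hi).2, ← hpart]
      exact P.part_mem.2 (Finset.mem_univ i)
  have hcard : P.parts.card = r := by
    rw [hparts, Finset.card_image_of_injective, Finset.card_univ, Fintype.card_fin]
    intro a b h
    obtain ⟨i, hi⟩ := hne a
    have hi' : i ∈ Finset.univ.filter fun j => c j = b := by
      rw [← show _ = Finset.univ.filter fun j => c j = b from h]
      exact hi
    exact (Finset.mem_filter.1 hi).2.symm.trans (Finset.mem_filter.1 hi').2
  have heq : P.IsEquipartition := by
    intro A B hA hB
    rw [hparts] at hA hB
    obtain ⟨a, -, rfl⟩ := Finset.mem_image.1 (Finset.mem_coe.1 hA)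
    obtain ⟨b, -, rfl⟩ := Finset.mem_image.1 (Finset.mem_coe.1 hB)
    exact hc a b
  obtain ⟨f, hf⟩ := heq.exists_partPreservingEquiv
  refine ⟨⟨(Equiv.subtypeUnivEquiv Finset.mem_univ).symm.trans f, ?_⟩⟩
  intro i j
  have := hf ⟨i, Finset.mem_univ i⟩ ⟨j, Finset.mem_univ j⟩
  rw [hcard] at this
  rw [SimpleGraph.turanGraph_adj, multipartite_adj, not_iff_not.symm, not_ne_iff, not_ne_iff]
  refine this.symm.trans ?_
  rw [hpart, hpart]
  constructor
  · intro h
    have : i ∈ Finset.univ.filter fun k => c k = c j := h ▸ by simp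
    exact (Finset.mem_filter.1 this).2
  · intro h
    simp only [h]

/-- A positive form has an edge `a b` with both weights positive, and every vertex differs in colour
from `a` or from `b`, hence is adjacent to one of them. -/
theorem pos_of_graphForm_multipartite_eq [Nonempty V] {p : ℝ} (hp : 1 < p) {c : V → Fin r}
    {x : V → ℝ} (hx : ∀ i, 0 ≤ x i) (hx1 : ∑ i, |x i| ^ p = 1)
    (hM : graphForm (multipartite c) x = pSpectralRadius p (multipartite c))
    (hpos : 0 < pSpectralRadius p (multipartite c)) (i : V) : 0 < x i := by
  classical
  rw [← hM, graphForm_eq_sum] at hpos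
  obtain ⟨a, -, ha⟩ := Finset.exists_ne_zero_of_sum_ne_zero hpos.ne'
  obtain ⟨b, -, hb⟩ := Finset.exists_ne_zero_of_sum_ne_zero ha
  obtain ⟨hab, hxab⟩ : (multipartite c).Adj a b ∧ x a * x b ≠ 0 := by
    split_ifs at hb with h
    · exact ⟨h, hb⟩
    · exact absurd rfl hb
  have hxa : 0 < x a := (hx a).lt_of_ne' (left_ne_zero_of_mul hxab)
  have hxb : 0 < x b := (hx b).lt_of_ne' (right_ne_zero_of_mul hxab)
  rw [multipartite_adj] at hab
  by_cases h : c i = c a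
  · exact pos_of_adj_of_graphForm_eq_pSpectralRadius hp _ hx hx1 hM
      ((multipartite_adj c).2 (h ▸ hab)) hxb
  · exact pos_of_adj_of_graphForm_eq_pSpectralRadius hp _ hx hx1 hM
      ((multipartite_adj c).2 h) hxa

/-- Among complete `r`-partite graphs on `V`, only the Turán graph maximises the `p`-spectral
radius. -/
theorem nonempty_iso_turanGraph_of_pSpectralRadius_max [Nonempty V] {p : ℝ} (hp : 1 < p)
    (hr : r ≤ Fintype.card V) {c : V → Fin r}
    (hpos : 0 < pSpectralRadius p (multipartite c))
    (hmax : ∀ c' : V → Fin r,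
      pSpectralRadius p (multipartite c') ≤ pSpectralRadius p (multipartite c)) :
    Nonempty (multipartite c ≃g SimpleGraph.turanGraph (Fintype.card V) r) := by
  obtain ⟨x, hx, hx1, hM⟩ := exists_nonneg_graphForm_eq_pSpectralRadius hp.le (multipartite c)
  refine nonempty_iso_turanGraph_of_balanced hr fun a b => ?_
  by_contra! h
  obtain ⟨c', hc'⟩ := exists_pSpectralRadius_multipartite_lt hp
    (pos_of_graphForm_multipartite_eq hp hx hx1 hM hpos) hx1 hM hpos (a := a) (b := b) (by omega)
  exact (hmax c').not_gt hc'

theorem exists_multipartite_graphForm_le (G : SimpleGraph V) (hG : G.CliqueFree (r + 1))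
    {x : V → ℝ} (hx : ∀ i, 0 ≤ x i) : ∃ c : V → Fin r,
      graphForm G x ≤ graphForm (multipartite c) x ∧
      ((∀ i, 0 < x i) → graphForm G x = graphForm (multipartite c) x → G = multipartite c) := by
  obtain ⟨c, hc, hle, heq⟩ := exists_coloring_pairWeight_le G hx r Finset.univ hG.cliqueFreeOn
  have hcol : graphForm (multipartite fun i => ⟨c i, hc i (Finset.mem_univ i)⟩) x =
      pairWeight x (fun i j => c i ≠ c j) Finset.univ Finset.univ := by
    rw [graphForm_eq_pairWeight]
    exact pairWeight_congr fun i _ j _ => by simp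
  refine ⟨fun i => ⟨c i, hc i (Finset.mem_univ i)⟩, ?_, fun hpos h => ?_⟩
  · rw [hcol, graphForm_eq_pairWeight]
    exact hle
  · rw [hcol, graphForm_eq_pairWeight] at h
    ext i j
    rw [heq hpos h i (Finset.mem_univ i) j (Finset.mem_univ j)]
    simp

end Turan

/-! ### Conclusion -/

theorem theorem2 {V : Type*} [Fintype V] [Nonempty V] (n ω : ℕ) (p : ℝ) (hp : 1 < p)
    (G : SimpleGraph V) (hn : Fintype.card V = n) (hω : G.cliqueNum = ω)
    (hG : ¬ Nonempty (G ≃g SimpleGraph.turanGraph n ω)) :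
    pSpectralRadius p G < pSpectralRadius p (SimpleGraph.turanGraph n ω) := by
  subst hn
  obtain ⟨v⟩ := ‹Nonempty V›
  have : Nonempty V := ⟨v⟩
  have hω1 : 1 ≤ ω := hω ▸ SimpleGraph.IsClique.card_le_cliqueNum (t := {v}) (tc := by simp)
  obtain ⟨K, hK⟩ := G.exists_isNClique_cliqueNum
  rw [hω] at hK
  have hωn : ω ≤ Fintype.card V := hK.card_eq ▸ Finset.card_le_univ K
  have hfree : G.CliqueFree (ω + 1) := fun t ht => by
    have := SimpleGraph.IsClique.card_le_cliqueNum (tc := ht.isClique)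
    rw [ht.card_eq, hω] at this
    omega
  have : NeZero ω := ⟨by omega⟩
  by_cases hadj : ∃ u w, G.Adj u w
  · obtain ⟨u, w, huw⟩ := hadj
    have hGpos := pSpectralRadius_pos hp.le huw
    obtain ⟨c₀, hc₀⟩ := Finite.exists_max fun c : V → Fin ω => pSpectralRadius p (multipartite c)
    obtain ⟨x, hx, hx1, hM⟩ := exists_nonneg_graphForm_eq_pSpectralRadius hp.le G
    obtain ⟨c, hle, heq⟩ := exists_multipartite_graphForm_le G hfree hx
    have hc := graphForm_le_pSpectralRadius hp.le (multipartite c) hx1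
    have hc₀pos : 0 < pSpectralRadius p (multipartite c₀) := by linarith [hc₀ c]
    obtain ⟨f⟩ := nonempty_iso_turanGraph_of_pSpectralRadius_max hp hωn hc₀pos hc₀
    rw [← pSpectralRadius_congr f p]
    -- The chain from `G` through its form at `x`, `multipartite c` and `multipartite c₀` now closes
    -- up, so `c` is optimal too.
    by_contra! hcon
    have hcc₀ := hc₀ c
    have hcM : graphForm (multipartite c) x = pSpectralRadius p (multipartite c) := by linarith
    have hcpos : 0 < pSpectralRadius p (multipartite c) := by linarith
    have hGc := heq (pos_of_graphForm_multipartite_eq hp hx hx1 hcM hcpos) (by linarith)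
    rw [hGc] at hG
    exact hG (nonempty_iso_turanGraph_of_pSpectralRadius_max hp hωn hcpos fun c' => by
      linarith [hc₀ c'])
  -- Without edges the spectral radius gives no positivity to work with, but then `ω = 1` and `G` is
  -- already the Turán graph.
  · push Not at hadj
    have hω' : ω = 1 := by
      have : K.card ≤ 1 := Finset.card_le_one.2 fun a ha b hb => by
        by_contra hab
        exact hadj a b (hK.isClique ha hb hab)
      rw [hK.card_eq] at this
      omega
    subst hω'
    refine absurd ⟨⟨Fintype.equivFin V, ?_⟩⟩ hG
    intro a b
    simp [SimpleGraph.turanGraph_adj, hadj, Nat.mod_one]
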